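/- **Parameterized hybrid systems.** Let $Q$ be a finite set of modes, $E\subset Q\times Q$ a set of edges, and $P=\{p\in\mathbb R^{m}:\pi_k(p)\ge 0,\ k=1,\dots,K\}$ with polynomials $\pi_k$. For $p\in P$ let $H(p)=(Q,E,D(p),F(p),G(p),R(p))$ be the hybrid system with state space $\mathbb R^n$ given by domains $D_q(p)=\{x: g_{q,k}(x,p)\ge 0,\ k=1,\dots,K_q\}$, guards $G_e(p)=\{x\in D_q(p): h_{e,0}(x,p)=0,\ h_{e,k}(x,p)\ge 0,\ k=1,\dots,N_e\}$ for $e=(q,q')\in E$, vector fields $f_q(x,p)$ and reset maps $\phi_e(\cdot,p):G_e(p)\to D_{q'}(p)$, where $g_{q,k},h_{e,k}$ and the components of $f_q,\phi_e$ are polynomials in $(x,p)$. Suppose each $H(p)$ is cyclic: every mode is the source of exactly one edge and the target of exactly one edge, and the directed graph $(Q,E)$ is connected. Let $z=\{z_q\}_{q\in Q}$ be a common Zeno equilibrium: for all $p\in P$, $z_q\in D_q(p)$ and $f_q(z_q,p)\ne0$ for all $q\in Q$, and $z_q\in G_e(p)$, $\phi_e(z_q,p)=z_{q'}$ for all $e=(q,q')\in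 E$. **Executions.** An execution of $H(p)$ from $(q_0,x_0)$ consists of an index set $I$, either $\mathbb N=\{0,1,2,\dots\}$ or a nonempty finite initial segment of it, times $0=\tau_0\le\tau_1\le\cdots$ (finite, except that if $I$ is finite the final time may be $+\infty$), modes $q_i$ and continuous functions $c_i$ on $[\tau_i,\tau_{i+1}]$ (on $[\tau_i,\infty)$ if $\tau_{i+1}=\infty$), for $i\in I$, such that $c_0(0)=x_0$; $\dot c_i=f_{q_i}(c_i,p)$ and $c_i\in D_{q_i}(p)$ on $(\tau_i,\tau_{i+1})$; and, whenever $i+1\in I$, $e_i:=(q_i,q_{i+1})\in E$, $c_i(\tau_{i+1})\in G_{e_i}(p)$ and $c_{i+1}(\tau_{i+1})=\phi_{e_i}(c_i(\tau_{i+1}),p)$. It is *complete* if $I=\mathbb N$ or the final time is $+\infty$, and *Zeno* if $I=\mathbb N$ and $\lim_i\tau_i<\infty$. It *ends in a deadlock* if $I$ is finite, the final time is finite, and from the final state $(q,x)$ the system can neither jump ($x$ is in no guard of an edge leaving $q$) nor flow (no solution of $\dot y=f_q(y,p)$, $y(0)=x$, stays in $D_q(p)$ for a positive time). $z$ is *Zeno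 stable* for $H(p)$ if there are neighborhoods $Z_q$ of $z_q$ such that for all $q\in Q$ and $x_0\in Z_q$: (i) every complete execution from $(q,x_0)$ is Zeno, and for every $\epsilon>0$ there is $N$ with $\|c_i(\tau_{i+1})-z_{q_i}\|\le\epsilon$ for all $i>N$; (ii) if $x_0\in D_q(p)$, there is an execution from $(q,x_0)$ that is complete or ends in a deadlock (so a Zeno execution exists unless a deadlock can be reached). **Theorem.** Let $W_q\subset\mathbb R^n$ be open neighborhoods of $z_q$. Suppose there are continuously differentiable functions $V_q(x,p)$ on $\{(x,p):p\in P,\ x\in D_q(p)\}$ (that is, $V_q$ is $C^1$ on an open subset of $\mathbb R^n\times\mathbb R^m$ containing this set), constants $r_q\in(0,1]$ for $q\in Q$ with $r_q<1$ for some $q$, and a constant $\gamma>0$, such that for all $p\in P$ 1. $V_q(x,p)>0$ for all $q\in Q$ and $x\in (W_q\cap D_q(p))\setminus\{z_q\}$; 2. $V_q(z_q,p)=0$ for all $q\in Q$; 3. $\nabla_xV_q(x,p)^{T}f_q(x,p)\le-\gamma$ for all $q\in Q$ and $x\in W_q\cap D_q(p)$; 4. $V_{q'}(\phi_e(x,p),p)\le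 r_qV_q(x,p)$ for all $e=(q,q')\in E$ and $x\in G_e(p)\cap W_q$. Then, for every $p\in P$, $z$ is a Zeno stable Zeno equilibrium of $H(p)$. -/

import Mathlib

open Set Filter Topology

/-- A hybrid system `(Q, E, D, F, G, R)` with continuous state space `ℝⁿ` and mode set `Q`.
The vector fields and the reset maps are total functions; only their values on the domains,
respectively on the guards of edges, are ever used. -/
structure HybridSystem (Q : Type*) (n : ℕ) where
  E : Set (Q × Q)
  D : Q → Set (EuclideanSpace ℝ (Fin n))
  f : Q → EuclideanSpace ℝ (Fin n) → EuclideanSpace ℝ (Fin n)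
  G : Q × Q → Set (EuclideanSpace ℝ (Fin n))
  φ : Q × Q → EuclideanSpace ℝ (Fin n) → EuclideanSpace ℝ (Fin n)
  guard_subset : ∀ e ∈ E, G e ⊆ D e.1
  reset_mem : ∀ e ∈ E, ∀ x ∈ G e, φ e x ∈ D e.2

namespace HybridSystem

variable {Q : Type*} {n : ℕ}

/-- Every mode is the source of exactly one edge and the target of exactly one edge, and the
directed graph of modes and edges is connected. -/
def IsCyclic (H : HybridSystem Q n) : Prop :=
  (∀ q, ∃! e, e ∈ H.E ∧ e.1 = q) ∧ (∀ q, ∃! e, e ∈ H.E ∧ e.2 = q) ∧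
    ∀ q q', Relation.ReflTransGen (fun a b => (a, b) ∈ H.E) q q'

/-- `z` is a Zeno equilibrium. -/
def IsZenoEquilibrium (H : HybridSystem Q n) (z : Q → EuclideanSpace ℝ (Fin n)) : Prop :=
  (∀ q, z q ∈ H.D q) ∧ (∀ e ∈ H.E, z e.1 ∈ H.G e ∧ H.φ e (z e.1) = z e.2) ∧
    ∀ q, H.f q (z q) ≠ 0

/-- An execution with initial condition `(q₀, x₀)`. Intervals are numbered from `0`. The index
set `I` is `ℕ` or a finite initial segment of `ℕ`. The `i`-th interval runs from `τ i` to
`τ (i + 1)`; it may be degenerate, and only the last one, if there is a last one, may be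
unbounded (`τ (i + 1) = ⊤`). -/
structure Execution (H : HybridSystem Q n) (q₀ : Q) (x₀ : EuclideanSpace ℝ (Fin n)) where
  I : Set ℕ
  τ : ℕ → EReal
  mode : ℕ → Q
  c : ℕ → ℝ → EuclideanSpace ℝ (Fin n)
  zero_mem : 0 ∈ I
  mem_of_succ_mem : ∀ i, i + 1 ∈ I → i ∈ I
  τ_zero : τ 0 = 0
  τ_le_succ : ∀ i ∈ I, τ i ≤ τ (i + 1)
  τ_ne_top : ∀ i ∈ I, τ i ≠ ⊤
  init_mode : mode 0 = q₀
  init_state : c 0 0 = x₀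
  continuousOn : ∀ i ∈ I, ContinuousOn (c i) {t : ℝ | τ i ≤ (t : EReal) ∧ (t : EReal) ≤ τ (i + 1)}
  flow : ∀ i ∈ I, ∀ t : ℝ, τ i < (t : EReal) → (t : EReal) < τ (i + 1) →
    HasDerivAt (c i) (H.f (mode i) (c i t)) t
  mem_domain : ∀ i ∈ I, ∀ t : ℝ, τ i < (t : EReal) → (t : EReal) < τ (i + 1) →
    c i t ∈ H.D (mode i)
  mem_edge : ∀ i, i + 1 ∈ I → (mode i, mode (i + 1)) ∈ H.E
  mem_guard : ∀ i, i + 1 ∈ I → c i (τ (i + 1)).toReal ∈ H.G (mode i, mode (i + 1))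
  reset : ∀ i, i + 1 ∈ I →
    c (i + 1) (τ (i + 1)).toReal = H.φ (mode i, mode (i + 1)) (c i (τ (i + 1)).toReal)

/-- In the state `(q, x)` the system can neither jump (no guard of an edge leaving `q` contains
`x`) nor flow (no solution of `y' = f_q(y)`, `y(0) = x`, stays in `D_q` for a positive time). -/
def IsDeadlock (H : HybridSystem Q n) (q : Q) (x : EuclideanSpace ℝ (Fin n)) : Prop :=
  (∀ e ∈ H.E, e.1 = q → x ∉ H.G e) ∧
    ¬ ∃ δ : ℝ, 0 < δ ∧ ∃ y : ℝ → EuclideanSpace ℝ (Fin n), y 0 = x ∧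
      ContinuousOn y (Icc 0 δ) ∧
      ∀ t ∈ Ioo 0 δ, HasDerivAt y (H.f q (y t)) t ∧ y t ∈ H.D q

namespace Execution

variable {H : HybridSystem Q n} {q₀ : Q} {x₀ : EuclideanSpace ℝ (Fin n)}

/-- The execution never stops: it has infinitely many intervals, or its last one is unbounded. -/
def IsComplete (χ : H.Execution q₀ x₀) : Prop :=
  χ.I = univ ∨ ∃ i ∈ χ.I, χ.τ (i + 1) = ⊤

/-- The execution has finitely many intervals, stops at a finite time, and its final state is a
deadlock. -/
def EndsInDeadlock (χ : H.Execution q₀ x₀) : Prop :=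
  ∃ i ∈ χ.I, i + 1 ∉ χ.I ∧ χ.τ (i + 1) ≠ ⊤ ∧
    H.IsDeadlock (χ.mode i) (χ.c i (χ.τ (i + 1)).toReal)

/-- A Zeno execution: infinitely many intervals in finite time. -/
def IsZeno (χ : H.Execution q₀ x₀) : Prop :=
  χ.I = univ ∧ ∃ L : ℝ, Tendsto χ.τ atTop (𝓝 (L : EReal))

end Execution

/-- Zeno stability of `z`. For every initial condition `(q, x₀)` with `x₀` near `z q`, every
complete execution is Zeno and its states at the ends of the time intervals approach `z`.
Moreover, if `x₀` lies in the domain, then there is a complete execution, unless one can run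
into a deadlock. -/
def IsZenoStable (H : HybridSystem Q n) (z : Q → EuclideanSpace ℝ (Fin n)) : Prop :=
  ∃ Z : Q → Set (EuclideanSpace ℝ (Fin n)), (∀ q, Z q ∈ 𝓝 (z q)) ∧
    ∀ q, ∀ x₀ ∈ Z q,
      (∀ χ : H.Execution q x₀, χ.IsComplete →
        χ.IsZeno ∧ ∀ ε : ℝ, 0 < ε → ∃ N : ℕ, ∀ i > N,
          ‖χ.c i (χ.τ (i + 1)).toReal - z (χ.mode i)‖ ≤ ε) ∧
      (x₀ ∈ H.D q → ∃ χ : H.Execution q x₀, χ.IsComplete ∨ χ.EndsInDeadlock)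

end HybridSystem

/-- The value at `(x, p)` of a polynomial in the state variables `x ∈ ℝⁿ` and the parameters
`p ∈ ℝᵐ`. -/
noncomputable def evalXP {n m : ℕ} (g : MvPolynomial (Fin n ⊕ Fin m) ℝ)
    (x : EuclideanSpace ℝ (Fin n)) (p : EuclideanSpace ℝ (Fin m)) : ℝ :=
  MvPolynomial.eval (Sum.elim (fun i => x i) (fun j => p j)) g

/-- The polynomial data of a parameterized hybrid system: `π` describes the parameter set, `g`
the domains, `h₀` (equality) and `h` (inequalities) the guards, `f` the vector fields, `φ` the
resets. -/
structure UncertainHybridData (Q : Type*) (n m : ℕ) where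
  E : Set (Q × Q)
  numParam : ℕ
  π : Fin numParam → MvPolynomial (Fin m) ℝ
  numDomain : Q → ℕ
  g : (q : Q) → Fin (numDomain q) → MvPolynomial (Fin n ⊕ Fin m) ℝ
  numGuard : Q × Q → ℕ
  h₀ : Q × Q → MvPolynomial (Fin n ⊕ Fin m) ℝ
  h : (e : Q × Q) → Fin (numGuard e) → MvPolynomial (Fin n ⊕ Fin m) ℝ
  f : Q → Fin n → MvPolynomial (Fin n ⊕ Fin m) ℝ
  φ : Q × Q → Fin n → MvPolynomial (Fin n ⊕ Fin m) ℝ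

namespace UncertainHybridData

variable {Q : Type*} {n m : ℕ}

/-- The semialgebraic set `P` of admissible parameters. -/
def P (A : UncertainHybridData Q n m) : Set (EuclideanSpace ℝ (Fin m)) :=
  {p | ∀ k, 0 ≤ MvPolynomial.eval (fun j => p j) (A.π k)}

/-- The domain `D_q(p)`. -/
def D (A : UncertainHybridData Q n m) (p : EuclideanSpace ℝ (Fin m)) (q : Q) :
    Set (EuclideanSpace ℝ (Fin n)) :=
  {x | ∀ k, 0 ≤ evalXP (A.g q k) x p}

/-- The guard `G_e(p)`. -/
def G (A : UncertainHybridData Q n m) (p : EuclideanSpace ℝ (Fin m)) (e : Q × Q) :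
    Set (EuclideanSpace ℝ (Fin n)) :=
  {x | x ∈ A.D p e.1 ∧ evalXP (A.h₀ e) x p = 0 ∧ ∀ k, 0 ≤ evalXP (A.h e k) x p}

/-- The vector field `f_q(·, p)`. -/
noncomputable def field (A : UncertainHybridData Q n m) (p : EuclideanSpace ℝ (Fin m)) (q : Q)
    (x : EuclideanSpace ℝ (Fin n)) : EuclideanSpace ℝ (Fin n) :=
  WithLp.toLp 2 (fun i => evalXP (A.f q i) x p)

/-- The reset map `φ_e(·, p)`. -/
noncomputable def reset (A : UncertainHybridData Q n m) (p : EuclideanSpace ℝ (Fin m))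
    (e : Q × Q) (x : EuclideanSpace ℝ (Fin n)) : EuclideanSpace ℝ (Fin n) :=
  WithLp.toLp 2 (fun i => evalXP (A.φ e i) x p)

end UncertainHybridData

/-- A parameterized hybrid system: polynomial data for which, at every admissible parameter, each
reset map sends its guard into the domain of the target mode. -/
structure UncertainHybridSystem (Q : Type*) (n m : ℕ) extends UncertainHybridData Q n m where
  reset_mem : ∀ p ∈ toUncertainHybridData.P, ∀ e ∈ E, ∀ x ∈ toUncertainHybridData.G p e,
    toUncertainHybridData.reset p e x ∈ toUncertainHybridData.D p e.2

/-- The hybrid system `H(p)` at an admissible parameter `p`. -/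
noncomputable def UncertainHybridSystem.at {Q : Type*} {n m : ℕ}
    (A : UncertainHybridSystem Q n m) (p : EuclideanSpace ℝ (Fin m)) (hp : p ∈ A.P) :
    HybridSystem Q n where
  E := A.E
  D := A.D p
  f := A.field p
  G := A.G p
  φ := A.reset p
  guard_subset := fun _ _ _ hx => hx.1
  reset_mem := A.reset_mem p hp

/-! Fix `p`. `V` acts as a clock: flowing for time `t` costs at least `γ * t` of `V`, and resets do
not refund any of it, as long as the states remain where the Lyapunov conditions hold.

To keep them there, take closed balls of radius `ρ` about the `z q` inside the `W q`. By compactness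
small values of `V` force closeness to `z q` (`exists_sublevel_subset_ball`), so for small `v` the
sublevel set `V ≤ v` stays off the boundary sphere, and the flow cannot leave the ball
(`solution_stays_in_sublevel`). Shrinking `v` further, continuity of the resets makes jumps land in
the next ball. This is a trap (`IsTrap`).

In a trap, `V + γ * τ` does not increase from one interval to the next, so all switching times are
at most `v / γ`, and a complete execution must be Zeno. `V` at the interval ends decreases to a
limit; cyclicity brings back infinitely often a mode with `r q < 1`, so the limit is zero and the
end states approach `z`.

For existence, flow as long as possible (`exists_maximal_flow`), jump if a guard allows it, and
repeat; where no jump is allowed, the state is a deadlock. -/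

/-- A continuous curve that runs in a closed set on an open interval does so on its closure. -/
theorem mem_Icc_of_mem_Ioo {E : Type*} [TopologicalSpace E] {y : ℝ → E} {C : Set E} {a b : ℝ}
    (hC : IsClosed C) (hab : a < b)
    (hy : ContinuousOn y (Icc a b)) (h : ∀ t ∈ Ioo a b, y t ∈ C) : ∀ t ∈ Icc a b, y t ∈ C := by
  have h1 : MapsTo y (closure (Ioo a b)) (closure C) := by
    refine MapsTo.closure_of_continuousOn (fun t ht => h t ht) ?_
    rwa [closure_Ioo hab.ne]
  rwa [closure_Ioo hab.ne, hC.closure_eq] at h1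

/-! ### Ordinary differential equations: uniqueness, existence, cut-off -/

section Ode

variable {E : Type*} [NormedAddCommGroup E] [NormedSpace ℝ E]

/-- A solution on an open interval, continuous up to the left endpoint, is a solution in the sense
of right derivatives. -/
theorem hasDerivWithinAt_Ici_of_solution {F : E → E} (hF : Continuous F) {y : ℝ → E} {a b : ℝ}
    (hy : ContinuousOn y (Icc a b)) (hd : ∀ t ∈ Ioo a b, HasDerivAt y (F (y t)) t) :
    ∀ t ∈ Ico a b, HasDerivWithinAt y (F (y t)) (Ici t) t := by
  intro t ht
  have hsub : Ioo t b ⊆ Ioo a b := Ioo_subset_Ioo_left ht.1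
  have hmem : Ioo t b ∈ 𝓝[>] t := Ioo_mem_nhdsGT ht.2
  have hcont : ContinuousWithinAt y (Ioo t b) t :=
    (hy t ⟨ht.1, ht.2.le⟩).mono (hsub.trans Ioo_subset_Icc_self)
  -- At `t = a` no derivative is given; it is recovered as the limit of the derivatives `F (y s)`
  -- from the right.
  refine hasDerivWithinAt_Ici_of_tendsto_deriv (s := Ioo t b)
    (fun s hs => (hd s (hsub hs)).differentiableAt.differentiableWithinAt) hcont hmem ?_
  have h1 : Tendsto (fun s => F (y s)) (𝓝[>] t) (𝓝 (F (y t))) := by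
    refine (hF.tendsto _).comp ?_
    rw [← nhdsWithin_Ioo_eq_nhdsGT ht.2]
    exact hcont
  refine h1.congr' ?_
  filter_upwards [hmem] with s hs
  exact (hd s (hsub hs)).deriv.symm

/-- Uniqueness of solutions of `y' = F y`, for curves differentiable on the open interval only. -/
theorem eqOn_of_solutions {F : E → E} {K : NNReal} (hF : LipschitzWith K F) {y w : ℝ → E}
    {a b : ℝ} (hy : ContinuousOn y (Icc a b)) (hdy : ∀ t ∈ Ioo a b, HasDerivAt y (F (y t)) t)
    (hw : ContinuousOn w (Icc a b)) (hdw : ∀ t ∈ Ioo a b, HasDerivAt w (F (w t)) t)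
    (h0 : y a = w a) : EqOn y w (Icc a b) :=
  ODE_solution_unique_of_mem_Icc_right (v := fun _ => F) (s := fun _ => univ) (K := K)
    (fun _ _ => hF.lipschitzOnWith) hy (hasDerivWithinAt_Ici_of_solution hF.continuous hy hdy)
    (fun _ _ => mem_univ _) hw (hasDerivWithinAt_Ici_of_solution hF.continuous hw hdw)
    (fun _ _ => mem_univ _) h0

/-- A bounded Lipschitz vector field has solutions on intervals of any length. -/
theorem exists_solution_of_bounded_lipschitz [CompleteSpace E] {F : E → E} {K : NNReal}
    (hF : LipschitzWith K F) {L : NNReal} (hL : ∀ x, ‖F x‖ ≤ L) (x : E) {T : ℝ} (hT : 0 ≤ T) :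
    ∃ y : ℝ → E, y 0 = x ∧ ContinuousOn y (Icc 0 T) ∧
      ∀ t ∈ Ioo 0 T, HasDerivAt y (F (y t)) t := by
  -- A curve of speed at most `L` stays within distance `L * T` up to time `T`, so the time interval
  -- need not shrink.
  have hp : IsPicardLindelof (fun _ => F) (tmin := 0) (tmax := T) ⟨0, le_refl _, hT⟩ x
      (L * T.toNNReal) 0 L K := by
    refine IsPicardLindelof.of_time_independent (fun y _ => hL y) hF.lipschitzOnWith ?_
    simp [hT]
  obtain ⟨y, hy0, hy⟩ := hp.exists_eq_forall_mem_Icc_hasDerivWithinAt₀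
  refine ⟨y, hy0, fun t ht => (hy t ht).continuousWithinAt, fun t ht => ?_⟩
  exact (hy t (Ioo_subset_Icc_self ht)).hasDerivAt (Icc_mem_nhds ht.1 ht.2)

/-- A `C¹` vector field agrees on a ball with a bounded Lipschitz one. -/
theorem exists_bounded_lipschitz_extension [FiniteDimensional ℝ E] {f : E → E}
    (hf : ContDiff ℝ 1 f) (z : E) {ρ : ℝ} (hρ : 0 < ρ) :
    ∃ F : E → E, (∃ K, LipschitzWith K F) ∧ (∃ L : NNReal, ∀ x, ‖F x‖ ≤ L) ∧
      ∀ x ∈ Metric.closedBall z ρ, F x = f x := by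
  let χ : ContDiffBump z := ⟨ρ, ρ + 1, hρ, by linarith⟩
  have hs : ContDiff ℝ 1 (fun x => χ x • f x) := χ.contDiff.smul hf
  have hc : HasCompactSupport (fun x => χ x • f x) := χ.hasCompactSupport.smul_right
  refine ⟨fun x => χ x • f x, ContDiff.lipschitzWith_of_hasCompactSupport hc hs one_ne_zero, ?_,
    fun x hx => ?_⟩
  · obtain ⟨C, hC⟩ := hc.exists_bound_of_continuous hs.continuous
    exact ⟨⟨max C 0, le_max_right _ _⟩, fun x => (hC x).trans (le_max_left _ _)⟩
  · simp [χ.one_of_mem_closedBall hx]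

end Ode

/-! ### Lyapunov functions along a single flow -/

/-- Small values of a function that is positive off `z` force the point to be near `z`. -/
theorem exists_sublevel_subset_ball {E : Type*} [PseudoMetricSpace E] [ProperSpace E] {V : E → ℝ}
    {D : Set E} {z : E} {ρ : ℝ} (hD : IsClosed D)
    (hV : ContinuousOn V (D ∩ Metric.closedBall z ρ))
    (hpos : ∀ x ∈ D ∩ Metric.closedBall z ρ, x ≠ z → 0 < V x) {η : ℝ} (hη : 0 < η) :
    ∃ v > 0, ∀ x ∈ D ∩ Metric.closedBall z ρ, V x ≤ v → dist x z < η := by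
  set K : Set E := D ∩ Metric.closedBall z ρ ∩ (Metric.ball z η)ᶜ with hK
  have hKc : IsCompact K := ((isCompact_closedBall z ρ).inter_left hD).inter_right
    Metric.isOpen_ball.isClosed_compl
  rcases K.eq_empty_or_nonempty with he | hne
  · refine ⟨1, one_pos, fun x hx _ => ?_⟩
    by_contra! h
    have : x ∈ K := ⟨hx, by simpa using h⟩
    simp [he] at this
  · obtain ⟨y, hy, hmin⟩ := hKc.exists_isMinOn hne (hV.mono inter_subset_left)
    have hyz : y ≠ z := by
      rintro rfl
      exact hy.2 (Metric.mem_ball_self hη)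
    have h0 := hpos y hy.1 hyz
    -- Half the minimum of `V` over the compact set of points at distance at least `η`.
    refine ⟨V y / 2, by positivity, fun x hx hv => ?_⟩
    by_contra! h
    have : V y ≤ V x := hmin (show x ∈ K from ⟨hx, by simpa using h⟩)
    linarith

section Lyapunov

variable {E : Type*} [NormedAddCommGroup E] [NormedSpace ℝ E]

/-- Along a solution in a set on which `V` decreases at rate `γ`. -/
theorem add_mul_le_of_decrease {V : E → ℝ} {f : E → E} {C : Set E} {γ a b : ℝ}
    (hV : ∀ x ∈ C, DifferentiableAt ℝ V x) (hdec : ∀ x ∈ C, fderiv ℝ V x (f x) ≤ -γ)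
    (hab : a ≤ b) {c : ℝ → E} (hc : ContinuousOn c (Icc a b))
    (hd : ∀ t ∈ Ioo a b, HasDerivAt c (f (c t)) t) (hC : ∀ t ∈ Icc a b, c t ∈ C) :
    V (c b) + γ * (b - a) ≤ V (c a) := by
  have hder : ∀ t ∈ Ioo a b, HasDerivAt (fun t => V (c t) + γ * (t - a))
      (fderiv ℝ V (c t) (f (c t)) + γ * 1) t := by
    intro t ht
    exact ((hV _ (hC t (Ioo_subset_Icc_self ht))).hasFDerivAt.comp_hasDerivAt t (hd t ht)).add
      (((hasDerivAt_id t).sub_const a).const_mul γ)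
  have hcont : ContinuousOn (fun t => V (c t) + γ * (t - a)) (Icc a b) := by
    refine ContinuousOn.add (fun t ht => ?_) (by fun_prop)
    exact (hV _ (hC t ht)).continuousAt.comp_continuousWithinAt (hc t ht)
  have hanti := antitoneOn_of_deriv_nonpos (convex_Icc a b) hcont
    (fun t ht => by
      rw [interior_Icc] at ht
      exact (hder t ht).differentiableAt.differentiableWithinAt)
    (fun t ht => by
      rw [interior_Icc] at ht
      rw [(hder t ht).deriv]
      linarith [hdec _ (hC t (Ioo_subset_Icc_self ht))])
  simpa using hanti (left_mem_Icc.2 hab) (right_mem_Icc.2 hab) hab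

/-- A solution in `D` that starts in the part `V ≤ v` of a ball remains there, if this part does
not reach the boundary of the ball. -/
theorem solution_stays_in_sublevel {V : E → ℝ} {f : E → E} {D : Set E} {z : E} {γ ρ v a b : ℝ}
    (hγ : 0 ≤ γ) (hV : ∀ x ∈ D ∩ Metric.closedBall z ρ, DifferentiableAt ℝ V x)
    (hdec : ∀ x ∈ D ∩ Metric.closedBall z ρ, fderiv ℝ V x (f x) ≤ -γ)
    (hsub : ∀ x ∈ D ∩ Metric.closedBall z ρ, V x ≤ v → dist x z < ρ)
    {c : ℝ → E} (hc : ContinuousOn c (Icc a b))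
    (hd : ∀ t ∈ Ioo a b, HasDerivAt c (f (c t)) t) (hD : ∀ t ∈ Icc a b, c t ∈ D)
    (ha : dist (c a) z ≤ ρ) (hva : V (c a) ≤ v) :
    ∀ t ∈ Icc a b, dist (c t) z < ρ ∧ V (c t) + γ * (t - a) ≤ V (c a) := by
  -- Staying in the closed ball up to time `t` already gives strict interiority at `t`.
  have key : ∀ t ∈ Icc a b, (∀ s ∈ Icc a t, dist (c s) z ≤ ρ) →
      dist (c t) z < ρ ∧ V (c t) + γ * (t - a) ≤ V (c a) := by
    intro t ht hs
    have h1 := add_mul_le_of_decrease hV hdec ht.1 (hc.mono (Icc_subset_Icc_right ht.2))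
      (fun s hs => hd s (Ioo_subset_Ioo_right ht.2 hs))
      (fun s hs' => ⟨hD s (Icc_subset_Icc_right ht.2 hs'), hs s hs'⟩)
    refine ⟨hsub _ ⟨hD t ht, hs t (right_mem_Icc.2 ht.1)⟩ ?_, h1⟩
    have : 0 ≤ γ * (t - a) := mul_nonneg hγ (sub_nonneg.2 ht.1)
    linarith
  have hdist : ContinuousOn (fun t => dist (c t) z) (Icc a b) := by fun_prop
  suffices h : ∀ t ∈ Icc a b, dist (c t) z < ρ from
    fun t ht => key t ht fun s hs => (h s ⟨hs.1, hs.2.trans ht.2⟩).le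
  by_contra! hne
  obtain ⟨t₀, ht₀, hρ₀⟩ := hne
  have hcl : IsClosed (Icc a b ∩ (fun t => dist (c t) z) ⁻¹' Ici ρ) :=
    hdist.preimage_isClosed_of_isClosed isClosed_Icc isClosed_Ici
  have hcomp : IsCompact (Icc a b ∩ (fun t => dist (c t) z) ⁻¹' Ici ρ) :=
    isCompact_Icc.of_isClosed_subset hcl inter_subset_left
  -- `s` is the first time at distance at least `ρ`; by continuity the distance is still at most `ρ`
  -- there, so `key` applies and contradicts the choice of `s`.
  obtain ⟨s, ⟨hs, hsρ⟩, hmin⟩ := hcomp.exists_isLeast ⟨t₀, ht₀, hρ₀⟩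
  have hbefore : ∀ u ∈ Ico a s, dist (c u) z < ρ := by
    intro u hu
    by_contra! hge
    exact absurd (hmin ⟨⟨hu.1, hu.2.le.trans hs.2⟩, hge⟩) (not_le.2 hu.2)
  have hs_le : dist (c s) z ≤ ρ := by
    rcases hs.1.eq_or_lt with rfl | has
    · exact ha
    · exact mem_Icc_of_mem_Ioo (C := Metric.closedBall z ρ) Metric.isClosed_closedBall has
        (hc.mono (Icc_subset_Icc_right hs.2))
        (fun u hu => (hbefore u (Ioo_subset_Ico_self hu)).le) s (right_mem_Icc.2 hs.1)
  refine absurd (key s hs fun u hu => ?_).1 (not_lt.2 hsρ)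
  rcases hu.2.eq_or_lt with rfl | hlt
  · exact hs_le
  · exact (hbefore u ⟨hu.1, hlt⟩).le

/-- A state in a trapping sublevel set flows in `D` up to a time at which no further flow in `D`
is possible. -/
theorem exists_maximal_flow [FiniteDimensional ℝ E] {V : E → ℝ} {f : E → E} {D : Set E} {z : E}
    {γ ρ v : ℝ} (hγ : 0 < γ) (hρ : 0 < ρ) (hD : IsClosed D) (hf : ContDiff ℝ 1 f)
    (hV : ∀ x ∈ D ∩ Metric.closedBall z ρ, DifferentiableAt ℝ V x)
    (hV0 : ∀ x ∈ D ∩ Metric.closedBall z ρ, 0 ≤ V x)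
    (hdec : ∀ x ∈ D ∩ Metric.closedBall z ρ, fderiv ℝ V x (f x) ≤ -γ)
    (hsub : ∀ x ∈ D ∩ Metric.closedBall z ρ, V x ≤ v → dist x z < ρ)
    {x : E} (hx : x ∈ D ∩ Metric.closedBall z ρ) (hxv : V x ≤ v) :
    ∃ T : ℝ, 0 ≤ T ∧ ∃ y : ℝ → E, y 0 = x ∧ ContinuousOn y (Icc 0 T) ∧
      (∀ t ∈ Ioo 0 T, HasDerivAt y (f (y t)) t) ∧ (∀ t ∈ Icc 0 T, y t ∈ D) ∧
      ¬ ∃ δ : ℝ, 0 < δ ∧ ∃ w : ℝ → E, w 0 = y T ∧ ContinuousOn w (Icc 0 δ) ∧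
        ∀ t ∈ Ioo 0 δ, HasDerivAt w (f (w t)) t ∧ w t ∈ D := by
  obtain ⟨F, ⟨K, hK⟩, ⟨L, hL⟩, hFf⟩ := exists_bounded_lipschitz_extension hf z hρ
  -- `V` permits a flow time of at most `v / γ`; the extra `1` leaves room to continue `y` past the
  -- maximal time.
  set T₀ : ℝ := v / γ + 1 with hT₀
  have hv0 : 0 ≤ v := (hV0 x hx).trans hxv
  have hT₀pos : 0 < T₀ := by positivity
  obtain ⟨y, hy0, hyc, hyd⟩ := exists_solution_of_bounded_lipschitz hK hL x hT₀pos.le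
  set C : Set E := D ∩ Metric.closedBall z ρ with hCdef
  have hC : IsClosed C := hD.inter Metric.isClosed_closedBall
  -- The ball is part of the condition because the cut-off field `F` equals `f` only there.
  set A : Set ℝ := {t | t ∈ Icc 0 T₀ ∧ ∀ s ∈ Icc 0 t, y s ∈ C} with hA
  have h0A : (0 : ℝ) ∈ A := by
    refine ⟨left_mem_Icc.2 hT₀pos.le, fun s hs => ?_⟩
    rw [Icc_self, mem_singleton_iff] at hs
    rwa [hs, hy0]
  have hbdd : BddAbove A := ⟨T₀, fun t ht => ht.1.2⟩
  set T := sSup A with hTdef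
  have hT0 : 0 ≤ T := le_csSup hbdd h0A
  have hTT₀ : T ≤ T₀ := csSup_le ⟨0, h0A⟩ fun t ht => ht.1.2
  have hyC : ∀ s ∈ Icc 0 T, y s ∈ C := by
    rcases hT0.eq_or_lt with h | h
    · rw [← h]
      exact h0A.2
    · refine mem_Icc_of_mem_Ioo hC h (hyc.mono (Icc_subset_Icc_right hTT₀)) fun s hs => ?_
      obtain ⟨t, htA, hst⟩ := exists_lt_of_lt_csSup ⟨0, h0A⟩ hs.2
      exact htA.2 s ⟨hs.1.le, hst.le⟩
  have hyc' : ContinuousOn y (Icc 0 T) := hyc.mono (Icc_subset_Icc_right hTT₀)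
  have hyf : ∀ t ∈ Ioo 0 T, HasDerivAt y (f (y t)) t := by
    intro t ht
    rw [← hFf _ (hyC t (Ioo_subset_Icc_self ht)).2]
    exact hyd t ⟨ht.1, ht.2.trans_le hTT₀⟩
  have hyT := solution_stays_in_sublevel hγ.le hV hdec hsub hyc' hyf (fun t ht => (hyC t ht).1)
    (by rw [hy0]; exact hx.2) (by rwa [hy0]) T (right_mem_Icc.2 hT0)
  have hlt : T < T₀ := by
    have h1 := hV0 _ (hyC T (right_mem_Icc.2 hT0))
    have h2 := hyT.2
    rw [hy0, sub_zero] at h2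
    have h3 : T ≤ v / γ := by
      rw [le_div_iff₀ hγ]
      linarith
    linarith
  refine ⟨T, hT0, y, hy0, hyc', hyf, fun t ht => (hyC t ht).1, ?_⟩
  rintro ⟨δ, hδ, w, hw0, hwc, hw⟩
  have hwcont : ContinuousWithinAt w (Icc 0 δ) 0 := hwc 0 (left_mem_Icc.2 hδ.le)
  have hnhds : ∀ᶠ t in 𝓝[Icc 0 δ] (0 : ℝ), w t ∈ Metric.ball z ρ :=
    hwcont (Metric.isOpen_ball.mem_nhds (by rw [hw0]; exact hyT.1))
  obtain ⟨ε, hε, hball⟩ := Metric.mem_nhdsWithin_iff.1 hnhds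
  -- A time short enough for `w` to be defined and inside the ball, and for `y` to be defined up to
  -- `T + σ`.
  set σ : ℝ := min (min (δ / 2) (ε / 2)) (T₀ - T) with hσ
  have hσ0 : 0 < σ := by
    rw [hσ]
    exact lt_min (lt_min (by positivity) (by positivity)) (by linarith)
  have hσδ : σ < δ := by
    have := (min_le_left (min (δ / 2) (ε / 2)) (T₀ - T)).trans (min_le_left _ _)
    linarith
  have hσε : σ < ε := by
    have := (min_le_left (min (δ / 2) (ε / 2)) (T₀ - T)).trans (min_le_right _ _)
    linarith
  have hσT : T + σ ≤ T₀ := by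
    have := min_le_right (min (δ / 2) (ε / 2)) (T₀ - T)
    linarith
  have hwball : ∀ t ∈ Icc 0 σ, w t ∈ Metric.closedBall z ρ := by
    intro t ht
    refine Metric.ball_subset_closedBall (hball ⟨?_, ht.1, ht.2.trans hσδ.le⟩)
    rw [Metric.mem_ball, Real.dist_eq, sub_zero, abs_of_nonneg ht.1]
    linarith [ht.2]
  -- Both curves solve the equation of `F` from the same point, so a further flow `w` in `D` would
  -- be a continuation of `y`, against the maximality of `T`.
  have heq : EqOn (fun t => y (T + t)) w (Icc 0 σ) := by
    refine eqOn_of_solutions hK (a := 0) (b := σ) ?_ ?_ (hwc.mono (Icc_subset_Icc_right hσδ.le)) ?_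
      (by simp [hw0])
    · refine hyc.comp (by fun_prop) fun t ht => ?_
      exact ⟨by linarith [ht.1], by linarith [ht.2]⟩
    · intro t ht
      exact (hyd (T + t) ⟨by linarith [ht.1], by linarith [ht.2]⟩).comp_const_add T t
    · intro t ht
      rw [hFf _ (hwball t (Ioo_subset_Icc_self ht))]
      exact (hw t ⟨ht.1, ht.2.trans hσδ⟩).1
  have hmem : T + σ ∈ A := by
    refine ⟨⟨by linarith, hσT⟩, fun s hs => ?_⟩
    rcases le_or_gt s T with h | h
    · exact hyC s ⟨hs.1, h⟩
    · have hs' : s - T ∈ Icc 0 σ := ⟨by linarith, by linarith [hs.2]⟩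
      have h1 := heq hs'
      simp only [add_sub_cancel] at h1
      rw [h1]
      exact ⟨(hw (s - T) ⟨by linarith, by linarith [hs'.2]⟩).2, hwball _ hs'⟩
  linarith [le_csSup hbdd hmem]

end Lyapunov

/-! ### Trapping regions and existence of executions -/

namespace HybridSystem

variable {Q : Type*} {n : ℕ}

/-- Balls of radius `ρ` about the points `z q` and a level `v` such that the sublevel sets
`V q ≤ v` in these balls are trapping regions on which `V` is a Lyapunov function. -/
structure IsTrap (H : HybridSystem Q n) (z : Q → EuclideanSpace ℝ (Fin n))
    (V : Q → EuclideanSpace ℝ (Fin n) → ℝ) (r : Q → ℝ) (γ ρ v : ℝ) : Prop where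
  γ_pos : 0 < γ
  ρ_pos : 0 < ρ
  r_le_one : ∀ q, r q ≤ 1
  isClosed : ∀ q, IsClosed (H.D q)
  differentiableAt : ∀ q, ∀ x ∈ H.D q ∩ Metric.closedBall (z q) ρ, DifferentiableAt ℝ (V q) x
  nonneg : ∀ q, ∀ x ∈ H.D q ∩ Metric.closedBall (z q) ρ, 0 ≤ V q x
  decrease : ∀ q, ∀ x ∈ H.D q ∩ Metric.closedBall (z q) ρ, fderiv ℝ (V q) x (H.f q x) ≤ -γ
  sublevel : ∀ q, ∀ x ∈ H.D q ∩ Metric.closedBall (z q) ρ, V q x ≤ v → dist x (z q) < ρ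
  reset_mem : ∀ e ∈ H.E, ∀ x ∈ H.G e ∩ Metric.closedBall (z e.1) ρ, V e.1 x ≤ v →
    H.φ e x ∈ Metric.closedBall (z e.2) ρ
  reset_le : ∀ e ∈ H.E, ∀ x ∈ H.G e ∩ Metric.closedBall (z e.1) ρ,
    V e.2 (H.φ e x) ≤ r e.1 * V e.1 x

/-- The trapping region in the mode `q`. -/
def trapRegion (H : HybridSystem Q n) (z : Q → EuclideanSpace ℝ (Fin n))
    (V : Q → EuclideanSpace ℝ (Fin n) → ℝ) (ρ v : ℝ) (q : Q) : Set (EuclideanSpace ℝ (Fin n)) :=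
  {x | x ∈ H.D q ∩ Metric.closedBall (z q) ρ ∧ V q x ≤ v}

namespace IsTrap

variable {H : HybridSystem Q n} {z : Q → EuclideanSpace ℝ (Fin n)}
  {V : Q → EuclideanSpace ℝ (Fin n) → ℝ} {r : Q → ℝ} {γ ρ v : ℝ}

theorem reset_le_self (h : H.IsTrap z V r γ ρ v) {e : Q × Q} (he : e ∈ H.E)
    {x : EuclideanSpace ℝ (Fin n)} (hx : x ∈ H.G e ∩ Metric.closedBall (z e.1) ρ) :
    V e.2 (H.φ e x) ≤ V e.1 x :=
  (h.reset_le e he x hx).trans <|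
    mul_le_of_le_one_left (h.nonneg _ x ⟨H.guard_subset e he hx.1, hx.2⟩) (h.r_le_one _)

theorem reset_mem_trapRegion (h : H.IsTrap z V r γ ρ v) {e : Q × Q} (he : e ∈ H.E)
    {x : EuclideanSpace ℝ (Fin n)} (hx : x ∈ H.trapRegion z V ρ v e.1) (hG : x ∈ H.G e) :
    H.φ e x ∈ H.trapRegion z V ρ v e.2 :=
  ⟨⟨H.reset_mem e he x hG, h.reset_mem e he x ⟨hG, hx.1.2⟩ hx.2⟩,
    (h.reset_le_self he ⟨hG, hx.1.2⟩).trans hx.2⟩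

/-- Executions guarantee the domain only on open intervals; closedness of the domain supplies the
endpoints needed by `solution_stays_in_sublevel`. -/
theorem solution_mem_trapRegion (h : H.IsTrap z V r γ ρ v) {q : Q} {a b : ℝ}
    {c : ℝ → EuclideanSpace ℝ (Fin n)} (hc : ContinuousOn c (Icc a b))
    (hd : ∀ t ∈ Ioo a b, HasDerivAt c (H.f q (c t)) t) (hD : ∀ t ∈ Ioo a b, c t ∈ H.D q)
    (ha : c a ∈ H.trapRegion z V ρ v q) {t : ℝ} (ht : t ∈ Icc a b) :
    c t ∈ H.trapRegion z V ρ v q ∧ V q (c t) + γ * (t - a) ≤ V q (c a) := by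
  have hD' : ∀ t ∈ Icc a b, c t ∈ H.D q := by
    rcases (ht.1.trans ht.2).eq_or_lt with rfl | hab
    · intro s hs
      rw [Icc_self, mem_singleton_iff] at hs
      exact hs ▸ ha.1.1
    · exact mem_Icc_of_mem_Ioo (h.isClosed q) hab hc hD
  have h1 := solution_stays_in_sublevel h.γ_pos.le (h.differentiableAt q) (h.decrease q)
    (h.sublevel q) hc hd hD' ha.1.2 ha.2 t ht
  have h2 := mul_nonneg h.γ_pos.le (sub_nonneg.2 ht.1)
  exact ⟨⟨⟨hD' t ht, h1.1.le⟩, by linarith [ha.2, h1.2]⟩, h1.2⟩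

/-- Flowing as long as possible and then jumping, a state in the trapping region has an execution
that is complete or ends in a deadlock. -/
theorem exists_execution (h : H.IsTrap z V r γ ρ v) (hf : ∀ q, ContDiff ℝ 1 (H.f q)) {q₀ : Q}
    {x₀ : EuclideanSpace ℝ (Fin n)} (hx₀ : x₀ ∈ H.trapRegion z V ρ v q₀) :
    ∃ χ : H.Execution q₀ x₀, χ.IsComplete ∨ χ.EndsInDeadlock := by
  classical
  let S := {s : Q × EuclideanSpace ℝ (Fin n) // s.2 ∈ H.trapRegion z V ρ v s.1}
  have hflow : ∀ s : S, _ := fun s => exists_maximal_flow h.γ_pos h.ρ_pos (h.isClosed s.1.1)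
    (hf s.1.1) (h.differentiableAt s.1.1) (h.nonneg s.1.1) (h.decrease s.1.1) (h.sublevel s.1.1)
    s.2.1 s.2.2
  choose T hT y hy0 hyc hyd hyD hmax using hflow
  have hyT : ∀ s : S, y s (T s) ∈ H.trapRegion z V ρ v s.1.1 := fun s =>
    (h.solution_mem_trapRegion (hyc s) (hyd s) (fun t ht => hyD s t (Ioo_subset_Icc_self ht))
      (by rw [hy0]; exact s.2) (right_mem_Icc.2 (hT s))).1
  let J : S → Prop := fun s => ∃ e ∈ H.E, e.1 = s.1.1 ∧ y s (T s) ∈ H.G e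
  -- `next` is made total by a dummy value where no jump is possible; the index set excludes
  -- everything after such a state.
  have hnext : ∀ s : S, ∃ s' : S, J s → (s.1.1, s'.1.1) ∈ H.E ∧
      y s (T s) ∈ H.G (s.1.1, s'.1.1) ∧ s'.1.2 = H.φ (s.1.1, s'.1.1) (y s (T s)) := by
    intro s
    by_cases hJ : J s
    · obtain ⟨⟨q, q'⟩, he, rfl, hG⟩ := hJ
      exact ⟨⟨(q', H.φ (s.1.1, q') (y s (T s))), h.reset_mem_trapRegion he (hyT s) hG⟩,
        fun _ => ⟨he, hG, rfl⟩⟩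
    · exact ⟨s, fun hs => absurd hs hJ⟩
  choose next hE hG hφ using hnext
  let st : ℕ → S := fun i => next^[i] ⟨(q₀, x₀), hx₀⟩
  have hst : ∀ i, st (i + 1) = next (st i) := fun i => Function.iterate_succ_apply' _ _ _
  let σ : ℕ → ℝ := fun i => ∑ j ∈ Finset.range i, T (st j)
  have hσ : ∀ i, σ (i + 1) = σ i + T (st i) := fun i => Finset.sum_range_succ _ _
  have hJ_of : ∀ i, (∀ j < i + 1, J (st j)) → J (st i) := fun i hi => hi i (Nat.lt_succ_self i)
  have hsub : ∀ i, σ (i + 1) - σ i = T (st i) := fun i => by rw [hσ]; ring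
  let χ : H.Execution q₀ x₀ :=
    { I := {i | ∀ j < i, J (st j)}
      τ := fun i => (σ i : EReal)
      mode := fun i => (st i).1.1
      c := fun i t => y (st i) (t - σ i)
      zero_mem := fun j hj => absurd hj (Nat.not_lt_zero j)
      mem_of_succ_mem := fun i hi j hj => hi j (hj.trans (Nat.lt_succ_self i))
      τ_zero := by simp [σ]
      τ_le_succ := fun i _ => by
        rw [EReal.coe_le_coe_iff, hσ]
        linarith [hT (st i)]
      τ_ne_top := fun i _ => EReal.coe_ne_top _
      init_mode := rfl
      init_state := by simp [σ, hy0, st]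
      continuousOn := fun i _ => by
        refine (hyc (st i)).comp (by fun_prop) fun t ht => ?_
        rw [mem_ofPred_eq, EReal.coe_le_coe_iff, EReal.coe_le_coe_iff, hσ] at ht
        exact ⟨by linarith [ht.1], by linarith [ht.2]⟩
      flow := fun i _ t h1 h2 => by
        rw [EReal.coe_lt_coe_iff] at h1 h2
        rw [hσ] at h2
        exact (hyd (st i) (t - σ i) ⟨by linarith, by linarith⟩).comp_sub_const t (σ i)
      mem_domain := fun i _ t h1 h2 => by
        rw [EReal.coe_lt_coe_iff] at h1 h2
        rw [hσ] at h2
        exact hyD (st i) (t - σ i) ⟨by linarith, by linarith⟩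
      mem_edge := fun i hi => by
        rw [hst]
        exact hE _ (hJ_of i hi)
      mem_guard := fun i hi => by
        rw [EReal.toReal_coe, hsub, hst]
        exact hG _ (hJ_of i hi)
      reset := fun i hi => by
        rw [EReal.toReal_coe, hsub, hst, sub_self, hy0]
        exact hφ _ (hJ_of i hi) }
  refine ⟨χ, ?_⟩
  by_cases hall : ∀ i, J (st i)
  · exact Or.inl (Or.inl (eq_univ_of_forall fun i j _ => hall j))
  · right
    push Not at hall
    -- The least index without a jump is the last interval: every earlier state jumps, and its
    -- successor is not in the index set.
    refine ⟨Nat.find hall, fun j hj => not_not.1 (Nat.find_min hall hj),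
      fun hi => Nat.find_spec hall (hJ_of _ hi), EReal.coe_ne_top _, ?_⟩
    generalize hk : Nat.find hall = k
    have hnJ : ¬ J (st k) := hk ▸ Nat.find_spec hall
    have hc : χ.c k (χ.τ (k + 1)).toReal = y (st k) (T (st k)) := by
      change y (st k) (((σ (k + 1) : ℝ) : EReal).toReal - σ k) = _
      rw [EReal.toReal_coe, hsub]
    rw [hc]
    exact ⟨fun e he he1 hG => hnJ ⟨e, he, he1, hG⟩, hmax (st k)⟩

end IsTrap

/-! ### Executions in a trapping region: Zeno behavior and convergence -/

namespace Execution

variable {H : HybridSystem Q n} {z : Q → EuclideanSpace ℝ (Fin n)}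
  {V : Q → EuclideanSpace ℝ (Fin n) → ℝ} {r : Q → ℝ} {γ ρ v : ℝ} {q₀ : Q}
  {x₀ : EuclideanSpace ℝ (Fin n)} (χ : H.Execution q₀ x₀)

theorem one_mem_of_mem {i : ℕ} (hi : i + 1 ∈ χ.I) : 1 ∈ χ.I := by
  induction i with
  | zero => exact hi
  | succ i ih => exact ih (χ.mem_of_succ_mem _ hi)

theorem τ_nonneg {i : ℕ} (hi : i ∈ χ.I) : 0 ≤ χ.τ i := by
  induction i with
  | zero => exact χ.τ_zero.ge
  | succ i ih =>
    have := χ.mem_of_succ_mem i hi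
    exact (ih this).trans (χ.τ_le_succ i this)

theorem coe_toReal_τ {i : ℕ} (hi : i ∈ χ.I) : ((χ.τ i).toReal : EReal) = χ.τ i :=
  EReal.coe_toReal (χ.τ_ne_top i hi) (ne_bot_of_le_ne_bot (by simp) (χ.τ_nonneg hi))

/-- The initial state of a complete execution lies in the domain. -/
theorem init_mem_of_isComplete (hD : IsClosed (H.D q₀)) (hχ : χ.IsComplete) : x₀ ∈ H.D q₀ := by
  have h0 := χ.zero_mem
  have h1 := χ.τ_le_succ 0 h0
  rw [χ.τ_zero] at h1
  rcases h1.eq_or_lt with h | h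
  · have h1I : 1 ∈ χ.I := by
      rcases hχ with hI | ⟨i, hi, hτ⟩
      · exact hI ▸ mem_univ 1
      · cases i with
        | zero => simp [← h] at hτ
        | succ i => exact χ.one_mem_of_mem hi
    have h2 := χ.mem_guard 0 h1I
    rw [← h, EReal.toReal_zero, χ.init_state] at h2
    have h3 := H.guard_subset _ (χ.mem_edge 0 h1I) h2
    rwa [χ.init_mode] at h3
  · obtain ⟨b, hb0, hb⟩ := EReal.lt_iff_exists_real_btwn.1 h
    have hb0' : 0 < b := by exact_mod_cast hb0
    have h2 := mem_Icc_of_mem_Ioo (y := χ.c 0) hD hb0' ((χ.continuousOn 0 h0).mono ?_) ?_ 0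
      (left_mem_Icc.2 hb0'.le)
    · rwa [χ.init_state] at h2
    · intro t ht
      rw [mem_ofPred_eq, χ.τ_zero]
      exact ⟨by exact_mod_cast ht.1, (EReal.coe_le_coe_iff.2 ht.2).trans hb.le⟩
    · intro t ht
      have h3 := χ.mem_domain 0 h0 t (by rw [χ.τ_zero]; exact_mod_cast ht.1)
        ((EReal.coe_lt_coe_iff.2 ht.2).trans hb)
      rwa [χ.init_mode] at h3

/-- The state at the start of the `i`-th interval. -/
noncomputable def startState (i : ℕ) : EuclideanSpace ℝ (Fin n) := χ.c i (χ.τ i).toReal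

/-- The state at the end of the `i`-th interval. -/
noncomputable def endState (i : ℕ) : EuclideanSpace ℝ (Fin n) := χ.c i (χ.τ (i + 1)).toReal

variable {χ}

/-- The time `b` is free, rather than the right end, so that unbounded last intervals are covered
too. -/
theorem segment_mem_trapRegion (h : H.IsTrap z V r γ ρ v) {i : ℕ} (hi : i ∈ χ.I)
    (hs : χ.startState i ∈ H.trapRegion z V ρ v (χ.mode i)) {b : ℝ}
    (hb : (χ.τ i).toReal ≤ b) (hb' : (b : EReal) ≤ χ.τ (i + 1)) :
    χ.c i b ∈ H.trapRegion z V ρ v (χ.mode i) ∧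
      V (χ.mode i) (χ.c i b) + γ * (b - (χ.τ i).toReal) ≤ V (χ.mode i) (χ.startState i) := by
  refine h.solution_mem_trapRegion (c := χ.c i) ((χ.continuousOn i hi).mono fun t ht => ?_)
    (fun t ht => χ.flow i hi t ?_ ?_) (fun t ht => χ.mem_domain i hi t ?_ ?_) hs
    (right_mem_Icc.2 hb)
  · rw [mem_ofPred_eq, ← χ.coe_toReal_τ hi]
    exact ⟨EReal.coe_le_coe_iff.2 ht.1, (EReal.coe_le_coe_iff.2 ht.2).trans hb'⟩
  all_goals first
    | exact (EReal.coe_lt_coe_iff.2 ht.2).trans_le hb'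
    | (rw [← χ.coe_toReal_τ hi]; exact EReal.coe_lt_coe_iff.2 ht.1)

theorem endState_mem (h : H.IsTrap z V r γ ρ v) {i : ℕ} (hi : i + 1 ∈ χ.I)
    (hs : χ.startState i ∈ H.trapRegion z V ρ v (χ.mode i)) :
    χ.endState i ∈ H.trapRegion z V ρ v (χ.mode i) ∧
      V (χ.mode i) (χ.endState i) + γ * ((χ.τ (i + 1)).toReal - (χ.τ i).toReal) ≤
        V (χ.mode i) (χ.startState i) := by
  have hi' := χ.mem_of_succ_mem i hi
  refine segment_mem_trapRegion h hi' hs ?_ (χ.coe_toReal_τ hi).le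
  rw [← EReal.coe_le_coe_iff, χ.coe_toReal_τ hi, χ.coe_toReal_τ hi']
  exact χ.τ_le_succ i hi'

theorem startState_succ {i : ℕ} (hi : i + 1 ∈ χ.I) :
    χ.startState (i + 1) = H.φ (χ.mode i, χ.mode (i + 1)) (χ.endState i) :=
  χ.reset i hi

theorem startState_mem (h : H.IsTrap z V r γ ρ v) (hx₀ : x₀ ∈ H.trapRegion z V ρ v q₀) {i : ℕ}
    (hi : i ∈ χ.I) : χ.startState i ∈ H.trapRegion z V ρ v (χ.mode i) := by
  induction i with
  | zero => rwa [startState, χ.τ_zero, EReal.toReal_zero, χ.init_state, χ.init_mode]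
  | succ i ih =>
    rw [startState_succ hi]
    exact h.reset_mem_trapRegion (χ.mem_edge i hi)
      (endState_mem h hi (ih (χ.mem_of_succ_mem i hi))).1 (χ.mem_guard i hi)

/-- Complete executions in a trapping region have infinitely many intervals. -/
theorem index_eq_univ (h : H.IsTrap z V r γ ρ v) (hx₀ : x₀ ∈ H.trapRegion z V ρ v q₀)
    (hχ : χ.IsComplete) : χ.I = univ := by
  rcases hχ with hI | ⟨i, hi, hτ⟩
  · exact hI
  · exfalso
    have hs := startState_mem h hx₀ hi
    have hv : 0 ≤ v := (h.nonneg _ _ hs.1).trans hs.2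
    have hγ := h.γ_pos
    -- Flowing for time `v / γ + 1` would cost `v + γ`, more than the available `v`.
    obtain ⟨h1, h2⟩ := segment_mem_trapRegion h hi hs (b := (χ.τ i).toReal + (v / γ + 1))
      (le_add_of_nonneg_right (by positivity)) (hτ ▸ le_top)
    have h3 : γ * (v / γ + 1) = v + γ := by field_simp
    rw [add_sub_cancel_left, h3] at h2
    linarith [h.nonneg _ _ h1.1, hs.2]

theorem lyapunov_startState_succ_le (h : H.IsTrap z V r γ ρ v)
    (hx₀ : x₀ ∈ H.trapRegion z V ρ v q₀) {i : ℕ} (hi : i + 1 ∈ χ.I) :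
    V (χ.mode (i + 1)) (χ.startState (i + 1)) ≤
      r (χ.mode i) * V (χ.mode i) (χ.endState i) := by
  rw [startState_succ hi]
  exact h.reset_le _ (χ.mem_edge i hi) _ ⟨χ.mem_guard i hi,
    (endState_mem h hi (startState_mem h hx₀ (χ.mem_of_succ_mem i hi))).1.1.2⟩

/-- Complete executions in a trapping region are Zeno. -/
theorem isZeno_of_isComplete (h : H.IsTrap z V r γ ρ v) (hx₀ : x₀ ∈ H.trapRegion z V ρ v q₀)
    (hχ : χ.IsComplete) : χ.IsZeno := by
  have hI := index_eq_univ h hx₀ hχ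
  have hmem : ∀ i, i ∈ χ.I := fun i => hI ▸ mem_univ i
  -- Nonnegativity of `V` turns this monotonicity into the bound `v / γ` on the times.
  have hanti : Antitone fun i =>
      V (χ.mode i) (χ.startState i) + γ * (χ.τ i).toReal := by
    refine antitone_nat_of_succ_le fun i => ?_
    have h1 := endState_mem h (hmem (i + 1)) (startState_mem h hx₀ (hmem i))
    have h2 := lyapunov_startState_succ_le h hx₀ (hmem (i + 1))
    have h3 := mul_le_of_le_one_left (h.nonneg _ _ h1.1.1) (h.r_le_one (χ.mode i))
    linarith [h1.2]
  have hmono : Monotone fun i => (χ.τ i).toReal := by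
    refine monotone_nat_of_le_succ fun i => ?_
    rw [← EReal.coe_le_coe_iff, χ.coe_toReal_τ (hmem _), χ.coe_toReal_τ (hmem _)]
    exact χ.τ_le_succ i (hmem i)
  have hbdd : BddAbove (range fun i => (χ.τ i).toReal) := by
    refine ⟨v / γ, ?_⟩
    rintro _ ⟨i, rfl⟩
    have h1 := hanti (Nat.zero_le i)
    have h2 := h.nonneg _ _ (startState_mem h hx₀ (hmem i)).1
    have h3 := (startState_mem h hx₀ (hmem 0)).2
    simp only [χ.τ_zero, EReal.toReal_zero, mul_zero, add_zero] at h1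
    rw [le_div_iff₀ h.γ_pos]
    linarith
  refine ⟨hI, ⨆ i, (χ.τ i).toReal, ?_⟩
  have h1 := (continuous_coe_real_ereal.tendsto _).comp (tendsto_atTop_ciSup hmono hbdd)
  exact h1.congr fun i => χ.coe_toReal_τ (hmem i)

/-- In a cyclic system an execution with infinitely many intervals visits each mode infinitely
often. -/
theorem frequently_mode_eq (hcyc : H.IsCyclic) (hI : χ.I = univ) (q : Q) :
    ∃ᶠ i in atTop, χ.mode i = q := by
  have key : ∀ a, Relation.ReflTransGen (fun a b => (a, b) ∈ H.E) a q →
      ∀ i, χ.mode i = a → ∃ k ≥ i, χ.mode k = q := by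
    intro a ha
    induction ha using Relation.ReflTransGen.head_induction_on with
    | refl => exact fun i hi => ⟨i, le_refl i, hi⟩
    | head hab _ ih =>
      intro i hi
      have hedge := χ.mem_edge i (hI ▸ mem_univ (i + 1))
      -- As each mode has only one outgoing edge, the execution must follow the path towards `q`.
      have huniq := (hcyc.1 (χ.mode i)).unique ⟨hedge, rfl⟩ ⟨hab, hi.symm⟩
      obtain ⟨k, hk, hkq⟩ := ih (i + 1) (congrArg Prod.snd huniq)
      exact ⟨k, (Nat.le_succ i).trans hk, hkq⟩
  exact frequently_atTop.2 fun i => key _ (hcyc.2.2 _ q) i rfl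

/-- Along an execution with infinitely many intervals in a trapping region the Lyapunov function
tends to zero. -/
theorem tendsto_lyapunov (h : H.IsTrap z V r γ ρ v) (hx₀ : x₀ ∈ H.trapRegion z V ρ v q₀)
    (hcyc : H.IsCyclic) (hr : ∃ q, r q < 1) (hI : χ.I = univ) :
    Tendsto (fun i => V (χ.mode i) (χ.endState i)) atTop (𝓝 0) := by
  have hmem : ∀ i, i ∈ χ.I := fun i => hI ▸ mem_univ i
  have hstart := fun i => startState_mem h hx₀ (hmem i)
  have hend := fun i => endState_mem h (hmem (i + 1)) (hstart i)
  have hτ : ∀ i, (χ.τ i).toReal ≤ (χ.τ (i + 1)).toReal := fun i => by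
    rw [← EReal.coe_le_coe_iff, χ.coe_toReal_τ (hmem _), χ.coe_toReal_τ (hmem _)]
    exact χ.τ_le_succ i (hmem i)
  have hend_le : ∀ i, V (χ.mode i) (χ.endState i) ≤ V (χ.mode i) (χ.startState i) := fun i => by
    linarith [(hend i).2, mul_nonneg h.γ_pos.le (sub_nonneg.2 (hτ i))]
  have hnext := fun i => lyapunov_startState_succ_le h hx₀ (hmem (i + 1))
  have hend0 := fun i => h.nonneg _ _ (hend i).1.1
  have hanti : Antitone fun i => V (χ.mode i) (χ.endState i) :=
    antitone_nat_of_succ_le fun i => (hend_le (i + 1)).trans <|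
      (hnext i).trans (mul_le_of_le_one_left (hend0 i) (h.r_le_one _))
  have hbdd : BddBelow (range fun i => V (χ.mode i) (χ.endState i)) :=
    ⟨0, by rintro _ ⟨i, rfl⟩; exact hend0 i⟩
  have hlim := tendsto_atTop_ciInf hanti hbdd
  set l := ⨅ i, V (χ.mode i) (χ.endState i) with hl
  have hl0 : 0 ≤ l := le_ciInf hend0
  suffices l = 0 by rwa [this] at hlim
  obtain ⟨q, hq⟩ := hr
  by_contra hne
  have hpos : 0 < l := lt_of_le_of_ne hl0 (Ne.symm hne)
  have hlt : r q * l < l := mul_lt_of_lt_one_left hpos hq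
  -- At a late visit to `q`, `V` is so close to `l` that the factor `r q` takes it below `l`, its
  -- infimum.
  obtain ⟨i, hiq, hi⟩ := ((frequently_mode_eq hcyc hI q).and_eventually
    ((hlim.const_mul (r q)).eventually_lt_const hlt)).exists
  have h1 : l ≤ V (χ.mode (i + 1)) (χ.endState (i + 1)) := ciInf_le hbdd (i + 1)
  have h2 := (hend_le (i + 1)).trans (hnext i)
  rw [hiq] at h2
  rw [hiq] at hi
  linarith

end Execution

/-! ### Zeno stability from a Lyapunov function -/

/-- A hybrid system with a Lyapunov function that decreases at a positive rate along the flow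
and does not increase at resets is Zeno stable. -/
theorem isZenoStable_of_lyapunov [Finite Q] {H : HybridSystem Q n} (hcyc : H.IsCyclic)
    {z : Q → EuclideanSpace ℝ (Fin n)} (hz : H.IsZenoEquilibrium z)
    (hD : ∀ q, IsClosed (H.D q)) (hf : ∀ q, ContDiff ℝ 1 (H.f q))
    (hφ : ∀ e ∈ H.E, Continuous (H.φ e)) {W : Q → Set (EuclideanSpace ℝ (Fin n))}
    (hW : ∀ q, W q ∈ 𝓝 (z q)) {V : Q → EuclideanSpace ℝ (Fin n) → ℝ}
    (hV : ∀ q, ∀ x ∈ W q ∩ H.D q, DifferentiableAt ℝ (V q) x) {r : Q → ℝ}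
    (hr : ∀ q, r q ≤ 1) (hr_lt : ∃ q, r q < 1) {γ : ℝ} (hγ : 0 < γ)
    (hpos : ∀ q, ∀ x ∈ W q ∩ H.D q, x ≠ z q → 0 < V q x) (hzero : ∀ q, V q (z q) = 0)
    (hdec : ∀ q, ∀ x ∈ W q ∩ H.D q, fderiv ℝ (V q) x (H.f q x) ≤ -γ)
    (hreset : ∀ e ∈ H.E, ∀ x ∈ H.G e ∩ W e.1, V e.2 (H.φ e x) ≤ r e.1 * V e.1 x) :
    H.IsZenoStable z := by
  obtain ⟨ρ, hρ, hρW⟩ : ∃ ρ > 0, ∀ q, Metric.closedBall (z q) ρ ⊆ W q := by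
    have h1 : ∀ᶠ ρ in 𝓝[>] (0 : ℝ), ∀ q, Metric.closedBall (z q) ρ ⊆ W q := by
      rw [eventually_all]
      intro q
      obtain ⟨ε, hε, hεW⟩ := Metric.nhds_basis_closedBall.mem_iff.1 (hW q)
      filter_upwards [Ioc_mem_nhdsGT hε] with ρ hρ
      exact (Metric.closedBall_subset_closedBall hρ.2).trans hεW
    obtain ⟨ρ, h2, h3⟩ := (h1.and self_mem_nhdsWithin).exists
    exact ⟨ρ, h3, h2⟩
  have hWD : ∀ q, ∀ x ∈ H.D q ∩ Metric.closedBall (z q) ρ, x ∈ W q ∩ H.D q :=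
    fun q x hx => ⟨hρW q hx.2, hx.1⟩
  -- Used twice: to choose the trap level `v`, and to turn `V → 0` into convergence of the states.
  have hsub : ∀ η > 0, ∃ v > 0, ∀ q, ∀ x ∈ H.D q ∩ Metric.closedBall (z q) ρ,
      V q x ≤ v → dist x (z q) < η := by
    intro η hη
    have h1 : ∀ᶠ v in 𝓝[>] (0 : ℝ), ∀ q, ∀ x ∈ H.D q ∩ Metric.closedBall (z q) ρ,
        V q x ≤ v → dist x (z q) < η := by
      rw [eventually_all]
      intro q
      obtain ⟨v, hv, hvq⟩ := exists_sublevel_subset_ball (V := V q) (hD q)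
        (fun x hx => (hV q x (hWD q x hx)).continuousAt.continuousWithinAt)
        (fun x hx => hpos q x (hWD q x hx)) hη
      filter_upwards [Ioc_mem_nhdsGT hv] with w hw x hx hxw
      exact hvq x hx (hxw.trans hw.2)
    obtain ⟨v, h2, h3⟩ := (h1.and self_mem_nhdsWithin).exists
    exact ⟨v, h3, h2⟩
  obtain ⟨η, hη, hηρ, hηφ⟩ : ∃ η > 0, η ≤ ρ ∧ ∀ e ∈ H.E, ∀ x, dist x (z e.1) < η →
      H.φ e x ∈ Metric.closedBall (z e.2) ρ := by
    have h1 : ∀ᶠ η in 𝓝[>] (0 : ℝ), ∀ e : Q × Q, e ∈ H.E → ∀ x, dist x (z e.1) < η →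
        H.φ e x ∈ Metric.closedBall (z e.2) ρ := by
      rw [eventually_all]
      intro e
      by_cases he : e ∈ H.E
      · have h2 := (hφ e he).continuousAt.preimage_mem_nhds (x := z e.1)
          (t := Metric.closedBall (z e.2) ρ)
          (by rw [(hz.2.1 e he).2]; exact Metric.closedBall_mem_nhds _ hρ)
        obtain ⟨ε, hε, hε'⟩ := Metric.mem_nhds_iff.1 h2
        filter_upwards [Ioc_mem_nhdsGT hε] with η hη _ x hx
        exact hε' (Metric.mem_ball.2 (hx.trans_le hη.2))
      · exact Eventually.of_forall fun _ h => absurd h he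
    obtain ⟨η, h2, h3⟩ := (h1.and (Ioc_mem_nhdsGT hρ)).exists
    exact ⟨η, h3.1, h3.2, h2⟩
  obtain ⟨v, hv, hvη⟩ := hsub η hη
  have htrap : H.IsTrap z V r γ ρ v :=
    { γ_pos := hγ
      ρ_pos := hρ
      r_le_one := hr
      isClosed := hD
      differentiableAt := fun q x hx => hV q x (hWD q x hx)
      nonneg := fun q x hx => by
        rcases eq_or_ne x (z q) with rfl | hne
        · exact (hzero q).ge
        · exact (hpos q x (hWD q x hx) hne).le
      decrease := fun q x hx => hdec q x (hWD q x hx)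
      sublevel := fun q x hx hxv => (hvη q x hx hxv).trans_le hηρ
      reset_mem := fun e he x hx hxv =>
        hηφ e he x (hvη _ x ⟨H.guard_subset e he hx.1, hx.2⟩ hxv)
      reset_le := fun e he x hx => hreset e he x ⟨hx.1, hρW _ hx.2⟩ }
  -- These sets are not cut with the domain, so that they are neighborhoods; a complete execution
  -- forces `x₀` into the domain anyway.
  refine ⟨fun q => {x | x ∈ Metric.closedBall (z q) ρ ∧ V q x ≤ v}, fun q => ?_,
    fun q x₀ hx₀ => ⟨fun χ hχ => ?_, fun hx => htrap.exists_execution hf ⟨⟨hx, hx₀.1⟩, hx₀.2⟩⟩⟩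
  · have hVz : ContinuousAt (V q) (z q) :=
      (hV q (z q) ⟨mem_of_mem_nhds (hW q), hz.1 q⟩).continuousAt
    exact inter_mem (Metric.closedBall_mem_nhds _ hρ)
      ((hVz.eventually_lt_const (by rwa [hzero])).mono fun _ => le_of_lt)
  · have hx : x₀ ∈ H.trapRegion z V ρ v q :=
      ⟨⟨χ.init_mem_of_isComplete (hD q) hχ, hx₀.1⟩, hx₀.2⟩
    have hzeno := Execution.isZeno_of_isComplete htrap hx hχ
    refine ⟨hzeno, fun ε hε => ?_⟩
    obtain ⟨w, hw, hwε⟩ := hsub ε hε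
    obtain ⟨N, hN⟩ := eventually_atTop.1 ((Execution.tendsto_lyapunov htrap hx hcyc hr_lt
      hzeno.1).eventually_lt_const hw)
    refine ⟨N, fun i hi => ?_⟩
    rw [← dist_eq_norm]
    have hmem : ∀ i, i ∈ χ.I := fun i => hzeno.1 ▸ mem_univ i
    exact (hwε _ _ (Execution.endState_mem htrap (hmem (i + 1))
      (Execution.startState_mem htrap hx (hmem i))).1.1 (hN i hi.le).le).le

end HybridSystem

/-! ### Polynomial data and the theorem -/

/-- A polynomial map in `(x, p)` is smooth in `x`. -/
theorem contDiff_evalXP {n m : ℕ} {k : WithTop ℕ∞} (g : MvPolynomial (Fin n ⊕ Fin m) ℝ)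
    (p : EuclideanSpace ℝ (Fin m)) : ContDiff ℝ k fun x => evalXP g x p := by
  unfold evalXP
  induction g using MvPolynomial.induction_on with
  | C a => simpa using contDiff_const
  | add a b ha hb => simpa using ha.add hb
  | mul_X a i ha =>
    simp only [map_mul, MvPolynomial.eval_X]
    refine ha.mul ?_
    cases i with
    | inl i =>
      simp only [Sum.elim_inl]
      fun_prop
    | inr j => exact contDiff_const

theorem mainTheorem4 {Q : Type*} [Fintype Q] {n m : ℕ} (H : UncertainHybridSystem Q n m)
    (hcyc : ∀ (p : EuclideanSpace ℝ (Fin m)) (hp : p ∈ H.P), (H.at p hp).IsCyclic)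
    (z : Q → EuclideanSpace ℝ (Fin n))
    (hz : ∀ (p : EuclideanSpace ℝ (Fin m)) (hp : p ∈ H.P), (H.at p hp).IsZenoEquilibrium z)
    (W : Q → Set (EuclideanSpace ℝ (Fin n)))
    (hW : ∀ q, IsOpen (W q) ∧ z q ∈ W q)
    (V : Q → EuclideanSpace ℝ (Fin n) → EuclideanSpace ℝ (Fin m) → ℝ)
    (hV : ∀ q, ∃ U : Set (EuclideanSpace ℝ (Fin n) × EuclideanSpace ℝ (Fin m)), IsOpen U ∧
      (∀ p ∈ H.P, ∀ x ∈ H.D p q, (x, p) ∈ U) ∧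
      ContDiffOn ℝ 1 (fun y => V q y.1 y.2) U)
    (r : Q → ℝ) (hr : ∀ q, 0 < r q ∧ r q ≤ 1) (hr_lt : ∃ q, r q < 1)
    (γ : ℝ) (hγ : 0 < γ)
    (hpos : ∀ q, ∀ p ∈ H.P, ∀ x ∈ W q ∩ H.D p q, x ≠ z q → 0 < V q x p)
    (hzero : ∀ q, ∀ p ∈ H.P, V q (z q) p = 0)
    (hdec : ∀ q, ∀ p ∈ H.P, ∀ x ∈ W q ∩ H.D p q,
      inner ℝ (gradient (fun y => V q y p) x) (H.field p q x) ≤ -γ)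
    (hreset : ∀ e ∈ H.E, ∀ p ∈ H.P, ∀ x ∈ H.G p e ∩ W e.1,
      V e.2 (H.reset p e x) p ≤ r e.1 * V e.1 x p) :
    ∀ (p : EuclideanSpace ℝ (Fin m)) (hp : p ∈ H.P),
      (H.at p hp).IsZenoEquilibrium z ∧ (H.at p hp).IsZenoStable z := by
  intro p hp
  refine ⟨hz p hp, HybridSystem.isZenoStable_of_lyapunov (hcyc p hp) (hz p hp) (fun q => ?_)
    (fun q => ?_) (fun e _ => ?_) (fun q => (hW q).1.mem_nhds (hW q).2)
    (V := fun q x => V q x p) (fun q x hx => ?_) (fun q => (hr q).2) hr_lt hγ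
    (fun q => hpos q p hp) (fun q => hzero q p hp) (fun q x hx => ?_)
    (fun e he => hreset e he p hp)⟩
  · change IsClosed {x | ∀ k, 0 ≤ evalXP (H.g q k) x p}
    rw [ofPred_forall]
    exact isClosed_iInter fun k =>
      isClosed_le continuous_const (contDiff_evalXP (k := 0) (H.g q k) p).continuous
  · exact (contDiff_euclidean (𝕜 := ℝ)).2 fun i => contDiff_evalXP (H.f q i) p
  · exact ((contDiff_euclidean (𝕜 := ℝ) (n := 0)).2 fun i => contDiff_evalXP (H.φ e i) p).continuous
  · obtain ⟨U, hU, hmem, hdiff⟩ := hV q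
    have h1 : DifferentiableAt ℝ (fun y : _ × _ => V q y.1 y.2) (x, p) :=
      (hdiff.differentiableOn one_ne_zero).differentiableAt (hU.mem_nhds (hmem p hp x hx.2))
    exact h1.comp (f := fun x => (x, p)) x (by fun_prop)
  · have h1 := hdec q p hp x hx
    rwa [gradient, InnerProductSpace.toDual_symm_apply] at h1
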